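/- Let $R$ be a hyperbolic automorphism of $\mathbb{Z}^2$ (that is, no complex eigenvalue of $R$ has modulus $1$), and let $G_R=\mathbb{Z}^2\rtimes_R\langle c\rangle$, where $c$ has infinite order and $cuc^{-1}=R(u)$ for $u\in\mathbb{Z}^2$. Let $a,b$ be the standard generators of $\mathbb{Z}^2$ and $S=\{a,b,c\}$. Let $F_S$ be the free group on $S$, with $l(w)$ the reduced word length of $w\in F_S$, and let $\sigma_R\colon F_S\to G_R$ be the natural homomorphism; for $g\in G_R$ let $|g|$ be the least length of an element of $\sigma_R^{-1}(g)$. Let $N$ be the normal closure of $\{a,b\}$ in $F_S$ and let $N_{ab}$ be its abelianization; for $v\in N_{ab}$ let $l(v)$ be its word length with respect to the generating set formed by the classes of all $c^iac^{-i}$ and $c^ibc^{-i}$, $i\in\mathbb{Z}$. Every element of $F_S$ is uniquely $xc^i$ with $x\in N$, $i\in\mathbb{Z}$; let $\phi\colon F_S\to N_{ab}$ send $xc^i$ to the class of $x$. Let $\pi\colon N_{ab}\to\mathbb{Z}^2$ be the homomorphism induced by $\sigma_R|_N$. For $g=uc^n$ with $u\in\mathbb{Z}^2$, $n\in\mathbb{Z}$,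 let $\|g\|$ be the least length of an element $w\in\sigma_R^{-1}(g)$ such that $\phi(w)$ has minimal length in $\pi^{-1}(u)$. Then there is a constant $D$, depending only on $R$, such that for all $u\in\mathbb{Z}^2$, all $n\in\mathbb{Z}$ and $g=uc^n$: 1. for every element $v$ of minimal length in $\pi^{-1}(u)$ there is $w\in F_S$ with $\phi(w)=v$, $\sigma_R(w)=g$ and $l(w)-D\le|g|\le l(w)$; 2. consequently, $\|g\|-D\le|g|\le\|g\|$. -/

import Mathlib

namespace SolGroup

/-- The lattice `ℤ²`. -/
abbrev Lattice : Type := Fin 2 → ℤ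

/-- An automorphism of `ℤ²` is hyperbolic if none of its (complex) eigenvalues has modulus one. -/
def IsHyperbolic (R : Lattice ≃+ Lattice) : Prop :=
  ∀ z : ℂ, Polynomial.aeval z (LinearMap.charpoly R.toAddMonoidHom.toIntLinearMap) = 0 → ‖z‖ ≠ 1

/-- The action of `ℤ` on `ℤ²` in which `n` acts by `R ^ n` (everything written multiplicatively). -/
def action (R : Lattice ≃+ Lattice) : Multiplicative ℤ →* MulAut (Multiplicative Lattice) :=
  zpowersHom (MulAut (Multiplicative Lattice)) (AddEquiv.toMultiplicative R)

/-- The group `G_R = ℤ² ⋊_R ℤ`. -/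
abbrev G (R : Lattice ≃+ Lattice) : Type :=
  Multiplicative Lattice ⋊[action R] Multiplicative ℤ

/-- The names of the three generators. -/
inductive Gen : Type
  | a
  | b
  | c
  deriving DecidableEq

/-- The free group `F_S` on the three generators. -/
abbrev F : Type := FreeGroup Gen

/-- The generators `a`, `b`, `c` as elements of `G_R`: the standard generators of `ℤ²` and of `ℤ`. -/
def gen (R : Lattice ≃+ Lattice) : Gen → G R
  | Gen.a => SemidirectProduct.inl (Multiplicative.ofAdd (Pi.single 0 1))
  | Gen.b => SemidirectProduct.inl (Multiplicative.ofAdd (Pi.single 1 1))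
  | Gen.c => SemidirectProduct.inr (Multiplicative.ofAdd 1)

/-- `σ_R : F_S → G_R` sends a word to the element that it represents. -/
def sigma (R : Lattice ≃+ Lattice) : F →* G R := FreeGroup.lift (gen R)

/-- `N`, the normal closure of `a` and `b` in `F_S`. -/
def N : Subgroup F := Subgroup.normalClosure {FreeGroup.of Gen.a, FreeGroup.of Gen.b}

instance : N.Normal := by
  unfold N
  infer_instance

/-- The abelianization of `N`. -/
abbrev Nab : Type := Abelianization N

/-- The total exponent of `c` in a word. -/
def cExp : F →* Multiplicative ℤ :=
  FreeGroup.lift fun s => match s with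
    | Gen.a => 1
    | Gen.b => 1
    | Gen.c => Multiplicative.ofAdd 1

/-- The power `c ^ i` in the free group. -/
def cPow (i : ℤ) : F := FreeGroup.of Gen.c ^ i

/-- The total exponent of `c`, as an integer. -/
def cDeg (g : F) : ℤ := Multiplicative.toAdd (cExp g)

theorem of_a_mem : FreeGroup.of Gen.a ∈ N := Subgroup.subset_normalClosure (by simp)

theorem of_b_mem : FreeGroup.of Gen.b ∈ N := Subgroup.subset_normalClosure (by simp)

theorem mul_cPow_mem (g : F) : g * (cPow (cDeg g))⁻¹ ∈ N := by
  have h : QuotientGroup.mk' N =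
      (zpowersHom (F ⧸ N) (QuotientGroup.mk' N (FreeGroup.of Gen.c))).comp cExp := by
    ext s
    cases s
    · have := (QuotientGroup.eq_one_iff (N := N) (FreeGroup.of Gen.a)).2 of_a_mem
      simp [cExp, this]
    · have := (QuotientGroup.eq_one_iff (N := N) (FreeGroup.of Gen.b)).2 of_b_mem
      simp [cExp, this]
    · simp [cExp, zpowersHom_apply]
  rw [← QuotientGroup.eq_one_iff]
  have h2 := DFunLike.congr_fun h g
  simp only [QuotientGroup.mk'_apply, MonoidHom.comp_apply, zpowersHom_apply] at h2
  rw [QuotientGroup.mk_mul, QuotientGroup.mk_inv, h2]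
  simp [cPow, cDeg]

/-- Every `g ∈ F_S` is uniquely `u * c ^ i` with `u ∈ N`; this is the factor `u`. -/
def nPart (g : F) : N := ⟨g * (cPow (cDeg g))⁻¹, mul_cPow_mem g⟩

/-- `φ : F_S → N_ab` sends `g = u * c ^ i`, with `u ∈ N`, to the class of `u` (it is not a
homomorphism). -/
def phi (g : F) : Nab := Abelianization.of (nPart g)

theorem cDeg_of_mem {x : F} (hx : x ∈ N) : cDeg x = 0 := by
  have h : N ≤ cExp.ker := by
    apply Subgroup.normalClosure_le_normal
    rintro y (rfl | rfl) <;> simp [cExp, MonoidHom.mem_ker]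
  have := h hx
  rw [MonoidHom.mem_ker] at this
  simp [cDeg, this]

/-- The defining property of `φ`; together with `mul_cPow_mem` it also gives the uniqueness of the
decomposition. -/
theorem phi_mul_cPow (u : N) (i : ℤ) : phi (u * cPow i) = Abelianization.of u := by
  have h : cDeg (u * cPow i) = i := by
    have := cDeg_of_mem u.2
    simp only [cDeg] at this
    have hc : cExp (cPow i) = Multiplicative.ofAdd i := by
      apply Multiplicative.toAdd.injective
      simp [cPow, cExp]
    simp [cDeg, map_mul, this, hc]
  unfold phi
  congr 1
  ext
  simp [nPart, h]

theorem sigma_right (R : Lattice ≃+ Lattice) {x : F} (hx : x ∈ N) : (sigma R x).right = 1 := by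
  have h : N ≤ (SemidirectProduct.rightHom.comp (sigma R)).ker := by
    apply Subgroup.normalClosure_le_normal
    rintro y (rfl | rfl) <;> simp [sigma, gen, MonoidHom.mem_ker]
  exact h hx

/-- `π : N_ab → ℤ²` sends the class of `x ∈ N` to the element of `ℤ² ⊆ G_R` represented
by `x`. -/
def proj (R : Lattice ≃+ Lattice) : Nab →* Multiplicative Lattice :=
  Abelianization.lift
    (MonoidHom.mk' (fun x : N => (sigma R x).left) (by
      intro x y
      simp [SemidirectProduct.mul_left, sigma_right R x.2]))

theorem inl_proj_of (R : Lattice ≃+ Lattice) (x : N) :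
    SemidirectProduct.inl (proj R (Abelianization.of x)) = sigma R x := by
  ext1
  · simp [proj]
  · simp [sigma_right R x.2]

/-- The conjugate `c ^ i * s * c ^ (-i)` of a generator, as an element of `N`, for `s ∈ {a, b}`. -/
def conjA (i : ℤ) : N :=
  ⟨cPow i * FreeGroup.of Gen.a * (cPow i)⁻¹, Subgroup.Normal.conj_mem inferInstance _ of_a_mem _⟩

/-- See `conjA`. -/
def conjB (i : ℤ) : N :=
  ⟨cPow i * FreeGroup.of Gen.b * (cPow i)⁻¹, Subgroup.Normal.conj_mem inferInstance _ of_b_mem _⟩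

/-- The standard free generating set of the abelian group `N_ab`: the classes of all conjugates of
`a` and `b` by powers of `c`. -/
def T : Set Nab :=
  {x | ∃ i : ℤ, x = Abelianization.of (conjA i) ∨ x = Abelianization.of (conjB i)}

/-- The length of an element of a group with respect to a generating set `A`: the least length of
a word in `A ∪ A⁻¹` that represents the element. -/
noncomputable def wordLength {H : Type*} [Group H] (A : Set H) (g : H) : ℕ :=
  sInf {k : ℕ | ∃ L : List H, (∀ x ∈ L, x ∈ A ∨ x⁻¹ ∈ A) ∧ L.prod = g ∧ L.length = k}

/-- The length of an element of `N_ab`. -/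
noncomputable def len (v : Nab) : ℕ := wordLength T v

theorem closure_T : Subgroup.closure T = ⊤ := by
  have conj : ∀ (s : F) (hs : s ∈ N) (g : F),
      (Abelianization.of (⟨g * s * g⁻¹, Subgroup.Normal.conj_mem inferInstance _ hs _⟩ : N) : Nab) =
      Abelianization.of (⟨cPow (cDeg g) * s * (cPow (cDeg g))⁻¹,
        Subgroup.Normal.conj_mem inferInstance _ hs _⟩ : N) := by
    intro s hs g
    have : (⟨g * s * g⁻¹, Subgroup.Normal.conj_mem inferInstance _ hs _⟩ : N) =
        nPart g * ⟨cPow (cDeg g) * s * (cPow (cDeg g))⁻¹,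
          Subgroup.Normal.conj_mem inferInstance _ hs _⟩ * (nPart g)⁻¹ := by
      ext
      simp [nPart, mul_assoc]
    rw [this]
    simp
  rw [eq_top_iff]
  rintro v -
  obtain ⟨⟨x, hx⟩, rfl⟩ := QuotientGroup.mk_surjective v
  change Abelianization.of (⟨x, hx⟩ : N) ∈ _
  have hx' : x ∈ Subgroup.closure
      (Group.conjugatesOfSet {FreeGroup.of Gen.a, FreeGroup.of Gen.b}) := hx
  have key : ∃ h : x ∈ N, Abelianization.of (⟨x, h⟩ : N) ∈ Subgroup.closure T := by
    induction hx' using Subgroup.closure_induction with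
    | mem y hy =>
      rw [Group.mem_conjugatesOfSet_iff] at hy
      obtain ⟨s, hs, hc⟩ := hy
      obtain ⟨g, rfl⟩ := isConj_iff.1 hc
      have hsN : s ∈ N := Subgroup.subset_normalClosure hs
      refine ⟨Subgroup.Normal.conj_mem inferInstance _ hsN _, ?_⟩
      rw [conj s hsN g]
      apply Subgroup.subset_closure
      refine ⟨cDeg g, ?_⟩
      rcases hs with rfl | rfl
      · exact Or.inl rfl
      · exact Or.inr rfl
    | one => exact ⟨N.one_mem, (Subgroup.closure T).one_mem⟩
    | mul y z hy hz ihy ihz =>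
      obtain ⟨h1, h1'⟩ := ihy hy
      obtain ⟨h2, h2'⟩ := ihz hz
      exact ⟨N.mul_mem h1 h2, (Subgroup.closure T).mul_mem h1' h2'⟩
    | inv y hy ihy =>
      obtain ⟨h1, h1'⟩ := ihy hy
      exact ⟨N.inv_mem h1, (Subgroup.closure T).inv_mem h1'⟩
  exact key.2

/-- The minimum in the definition of `len` is attained. -/
theorem exists_word_len (v : Nab) :
    ∃ L : List Nab, (∀ x ∈ L, x ∈ T ∨ x⁻¹ ∈ T) ∧ L.prod = v ∧ L.length = len v := by
  have hne : {k : ℕ | ∃ L : List Nab,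
      (∀ x ∈ L, x ∈ T ∨ x⁻¹ ∈ T) ∧ L.prod = v ∧ L.length = k}.Nonempty := by
    have hv : v ∈ Subgroup.closure T := by rw [closure_T]; trivial
    rw [← Subgroup.mem_toSubmonoid, Subgroup.closure_toSubmonoid] at hv
    obtain ⟨L, hL, hp⟩ := Submonoid.exists_list_of_mem_closure hv
    exact ⟨_, L, fun x hx => by simpa using hL x hx, hp, rfl⟩
  exact Nat.sInf_mem hne

/-- `v` is an element of minimal length of `π⁻¹(u)`. -/
def IsMinimalLift (R : Lattice ≃+ Lattice) (u : Multiplicative Lattice) (v : Nab) : Prop :=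
  proj R v = u ∧ ∀ v' : Nab, proj R v' = u → len v ≤ len v'

/-- The word norm `|g|`: the least length of an element of `σ_R⁻¹(g)`. -/
noncomputable def wordNorm (R : Lattice ≃+ Lattice) (g : G R) : ℕ :=
  sInf {k : ℕ | ∃ w : F, sigma R w = g ∧ w.norm = k}

/-- The restricted norm `‖g‖`: the least length of a word `w` representing `g = u * c ^ n` such
that `φ(w)` is an element of minimal length of `π⁻¹(u)`. -/
noncomputable def restrictedNorm (R : Lattice ≃+ Lattice) (g : G R) : ℕ :=
  sInf {k : ℕ | ∃ w : F, sigma R w = g ∧ IsMinimalLift R g.left (phi w) ∧ w.norm = k}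

theorem proj_surjective (R : Lattice ≃+ Lattice) : Function.Surjective (proj R) := by
  intro u
  refine ⟨Abelianization.of (conjA 0) ^ (Multiplicative.toAdd u 0) *
    Abelianization.of (conjB 0) ^ (Multiplicative.toAdd u 1), ?_⟩
  have ha : proj R (Abelianization.of (conjA 0)) = Multiplicative.ofAdd (Pi.single 0 1) := by
    simp [proj, conjA, cPow, sigma, gen]
  have hb : proj R (Abelianization.of (conjB 0)) = Multiplicative.ofAdd (Pi.single 1 1) := by
    simp [proj, conjB, cPow, sigma, gen]
  rw [map_mul, map_zpow, map_zpow, ha, hb]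
  apply Multiplicative.toAdd.injective
  funext i
  fin_cases i <;> simp

theorem exists_minimalLift (R : Lattice ≃+ Lattice) (u : Multiplicative Lattice) :
    ∃ v, IsMinimalLift R u v := by
  obtain ⟨v₀, h₀⟩ := proj_surjective R u
  have hne : ({v | proj R v = u} : Set Nab).Nonempty := ⟨v₀, h₀⟩
  refine ⟨Function.argminOn len {v | proj R v = u} hne, Function.argminOn_mem len _ hne, ?_⟩
  intro v' hv'
  exact Function.argminOn_le len _ hv'

theorem sigma_cPow (R : Lattice ≃+ Lattice) (n : ℤ) :
    sigma R (cPow n) = SemidirectProduct.inr (Multiplicative.ofAdd n) := by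
  rw [cPow, map_zpow]
  simp only [sigma, FreeGroup.lift_apply_of, gen]
  rw [← map_zpow, ← ofAdd_zsmul]
  simp

/-- The minimum in the definition of `‖g‖` is attained. -/
theorem restrictedNorm_spec (R : Lattice ≃+ Lattice) (g : G R) :
    ∃ w : F, sigma R w = g ∧ IsMinimalLift R g.left (phi w) ∧ w.norm = restrictedNorm R g := by
  have hne : {k : ℕ | ∃ w : F, sigma R w = g ∧ IsMinimalLift R g.left (phi w) ∧
      w.norm = k}.Nonempty := by
    obtain ⟨v, hv⟩ := exists_minimalLift R g.left
    obtain ⟨x, rfl⟩ := QuotientGroup.mk_surjective v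
    change IsMinimalLift R g.left (Abelianization.of x) at hv
    refine ⟨_, x * cPow (Multiplicative.toAdd g.right), ?_, ?_, rfl⟩
    · rw [map_mul, ← inl_proj_of, hv.1, sigma_cPow]
      exact SemidirectProduct.inl_left_mul_inr_right g
    · rw [phi_mul_cPow]
      exact hv
  exact Nat.sInf_mem hne

/-- The minimum in the definition of `|g|` is attained. -/
theorem wordNorm_spec (R : Lattice ≃+ Lattice) (g : G R) :
    ∃ w : F, sigma R w = g ∧ w.norm = wordNorm R g := by
  obtain ⟨w, hw, -⟩ := restrictedNorm_spec R g
  have hne : {k : ℕ | ∃ w : F, sigma R w = g ∧ w.norm = k}.Nonempty := ⟨_, w, hw, rfl⟩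
  exact Nat.sInf_mem hne

end SolGroup

/-! Encode an element of `N_ab` by a finitely supported family `f : ℤ → ℤ²`, with `f i` collecting
the letters `a`, `b` read at height `i`. Then `π` becomes `f ↦ ∑ R ^ i (f i)`, and length in `N_ab`
is the least `ℓ¹` size of an encoding family. A word ending at height `n` whose heights fill `[m,
M]` has length at least `size f + 2 * (M - m) - |n|`, and this bound is attained
(`exists_represents_mk`, `exists_word`). It therefore suffices that the support of a minimal family
`f` exceeds by a bounded amount the interval used by a geodesic word.

Hyperbolicity enters as `R ^ 8 + R ^ (-8) = τ` with `τ ≥ 47`. Trading `τ • z` at height `i` for `z`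
at `i + 8` and `i - 8` makes the entries of the geodesic's family bounded without raising its cost
(`exists_bounded_fam`); entries of a minimal family are bounded already.

Now let `g` be bounded with the same evaluation as `f`. The tails of `f - g` obey an approximate
recursion whose maximum principle bounds them (`exists_tail_bound`). Beyond the support of `g` these
are the tails of `f`, so they take finitely many values. If two tails of `f` agree, shifting the
farther one onto the nearer shows, by minimality, that `f` vanishes from there on
(`IsMinFam.eq_zero_of_tail_eq`). Pigeonhole bounds the overshoot on the right, and `i ↦ -i` gives
the left. -/

namespace SolGroup

/-! ### The `ℓ¹` norm on `ℤ²` and on finitely supported families -/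

/-- The `ℓ¹` norm on `ℤ²`. -/
def nrm (y : Lattice) : ℤ := |y 0| + |y 1|

theorem nrm_nonneg (y : Lattice) : 0 ≤ nrm y := by unfold nrm; positivity

@[simp] theorem nrm_zero : nrm 0 = 0 := by simp [nrm]

@[simp] theorem nrm_neg (y : Lattice) : nrm (-y) = nrm y := by simp [nrm]

theorem nrm_add_le (x y : Lattice) : nrm (x + y) ≤ nrm x + nrm y := by
  have h0 := abs_add_le (x 0) (y 0)
  have h1 := abs_add_le (x 1) (y 1)
  simp only [nrm, Pi.add_apply]
  linarith

theorem nrm_sub_le (x y : Lattice) : nrm (x - y) ≤ nrm x + nrm y := by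
  rw [sub_eq_add_neg, ← nrm_neg y]
  exact nrm_add_le _ _

theorem nrm_zsmul (n : ℤ) (y : Lattice) : nrm (n • y) = |n| * nrm y := by
  simp [nrm, abs_mul, mul_add]

theorem nrm_eq_zero {y : Lattice} (h : nrm y ≤ 0) : y = 0 := by
  unfold nrm at h
  have h0 := abs_nonneg (y 0)
  have h1 := abs_nonneg (y 1)
  have g0 : y 0 = 0 := abs_eq_zero.1 (by linarith)
  have g1 : y 1 = 0 := abs_eq_zero.1 (by linarith)
  funext i
  fin_cases i
  exacts [g0, g1]

theorem exists_nrm_map_le (h : Lattice →+ Lattice) :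
    ∃ r : ℤ, 0 ≤ r ∧ ∀ y, nrm (h y) ≤ r * nrm y := by
  refine ⟨nrm (h (Pi.single 0 1)) + nrm (h (Pi.single 1 1)),
    add_nonneg (nrm_nonneg _) (nrm_nonneg _), fun y => ?_⟩
  have hy : y = y 0 • Pi.single 0 1 + y 1 • Pi.single 1 1 := by
    funext i; fin_cases i <;> simp
  have hb : nrm (h y) ≤ |y 0| * nrm (h (Pi.single 0 1)) + |y 1| * nrm (h (Pi.single 1 1)) := by
    conv_lhs => rw [hy, map_add, map_zsmul, map_zsmul]
    refine (nrm_add_le _ _).trans ?_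
    rw [nrm_zsmul, nrm_zsmul]
  have h0 := mul_nonneg (abs_nonneg (y 0)) (nrm_nonneg (h (Pi.single 1 1)))
  have h1 := mul_nonneg (abs_nonneg (y 1)) (nrm_nonneg (h (Pi.single 0 1)))
  have : nrm y = |y 0| + |y 1| := rfl
  rw [this]
  linarith

theorem finite_nrm_le (K : ℤ) : {y : Lattice | nrm y ≤ K}.Finite := by
  refine (Set.finite_Icc (fun _ : Fin 2 => -K) (fun _ => K)).subset ?_
  intro y hy
  have hy' : |y 0| + |y 1| ≤ K := hy
  have h0 := abs_nonneg (y 0)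
  have h1 := abs_nonneg (y 1)
  have g0 := abs_le.1 (show |y 0| ≤ K by linarith)
  have g1 := abs_le.1 (show |y 1| ≤ K by linarith)
  constructor <;> intro i <;> fin_cases i
  exacts [g0.1, g1.1, g0.2, g1.2]

/-- Finitely supported families of elements of `ℤ²`, indexed by the powers of `c`. -/
abbrev Fam : Type := ℤ →₀ Lattice

/-- The `ℓ¹` norm of a finitely supported family. -/
def size (f : Fam) : ℤ := f.sum fun _ y => nrm y

theorem size_nonneg (f : Fam) : 0 ≤ size f := Finset.sum_nonneg fun _ _ => nrm_nonneg _

@[simp] theorem size_zero : size 0 = 0 := Finsupp.sum_zero_index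

@[simp] theorem size_single (i : ℤ) (y : Lattice) : size (Finsupp.single i y) = nrm y :=
  Finsupp.sum_single_index nrm_zero

theorem size_add_le (f g : Fam) : size (f + g) ≤ size f + size g := by
  classical
  have key : ∀ h : Fam, h.support ⊆ f.support ∪ g.support →
      size h = ∑ i ∈ f.support ∪ g.support, nrm (h i) := fun h hh =>
    Finsupp.sum_of_support_subset h hh _ fun _ _ => nrm_zero
  rw [key _ Finsupp.support_add, key f Finset.subset_union_left, key g Finset.subset_union_right,
    ← Finset.sum_add_distrib]
  exact Finset.sum_le_sum fun i _ => nrm_add_le _ _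

theorem nrm_add_size_erase (f : Fam) (i : ℤ) : nrm (f i) + size (f.erase i) = size f :=
  Finsupp.add_sum_erase' f i (fun _ y => nrm y) fun _ => nrm_zero

theorem nrm_le_size (f : Fam) (i : ℤ) : nrm (f i) ≤ size f := by
  have := nrm_add_size_erase f i
  have := size_nonneg (f.erase i)
  linarith

theorem eq_zero_of_size_le {f : Fam} (h : size f ≤ 0) : f = 0 := by
  ext1 i
  exact nrm_eq_zero ((nrm_le_size f i).trans h)

theorem size_filter_add (f : Fam) (p : ℤ → Prop) [DecidablePred p] :
    size (f.filter p) + size (f.filter fun i => ¬ p i) = size f :=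
  Finsupp.sum_filter_add_sum_filter_not p f (fun _ y => nrm y)

theorem size_mapDomain {s : ℤ → ℤ} (hs : Function.Injective s) (f : Fam) :
    size (f.mapDomain s) = size f :=
  Finsupp.sum_mapDomain_index_inj hs

/-! ### Evaluation of families -/

/-- Automorphisms of `ℤ²`. -/
abbrev Aut : Type := Lattice ≃ₗ[ℤ] Lattice

/-- The evaluation `f ↦ ∑ R ^ i (f i)`. -/
noncomputable def ev (R : Aut) : Fam →+ Lattice :=
  Finsupp.liftAddHom fun i : ℤ => (R ^ i).toLinearMap.toAddMonoidHom

@[simp] theorem ev_single (R : Aut) (i : ℤ) (y : Lattice) :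
    ev R (Finsupp.single i y) = (R ^ i) y := by
  simp [ev]

theorem zpow_add_apply (R : Aut) (i j : ℤ) (y : Lattice) :
    (R ^ (i + j)) y = (R ^ i) ((R ^ j) y) := by
  rw [zpow_add]; rfl

theorem ev_mapDomain_add (R : Aut) (k : ℤ) (f : Fam) :
    ev R (f.mapDomain (k + ·)) = (R ^ k) (ev R f) := by
  induction f using Finsupp.induction_linear with
  | zero => simp
  | add f g hf hg => simp [Finsupp.mapDomain_add, hf, hg]
  | single i y => simp [Finsupp.mapDomain_single, zpow_add_apply]

theorem ev_mapDomain_neg (R : Aut) (f : Fam) :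
    ev R⁻¹ (f.mapDomain Neg.neg) = ev R f := by
  induction f using Finsupp.induction_linear with
  | zero => simp
  | add f g hf hg => simp [Finsupp.mapDomain_add, hf, hg]
  | single i y => simp [Finsupp.mapDomain_single]

/-! ### Hyperbolicity -/

/-- `R ^ 8 + R ^ (-8)` is multiplication by `τ`. -/
def HasTrace (R : Aut) (τ : ℤ) : Prop :=
  ∀ y : Lattice, (R ^ (8 : ℤ)) y + (R ^ (-8 : ℤ)) y = τ • y

theorem HasTrace.inv {R : Aut} {τ : ℤ} (h : HasTrace R τ) : HasTrace R⁻¹ τ := by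
  intro y
  have := h y
  rw [← this, add_comm]
  simp

/-- Square `T + T⁻¹ = t` for `T = R ^ k`; the cross terms contribute `2`. -/
theorem trace_double (R : Aut) (k t : ℤ)
    (h : ∀ y : Lattice, (R ^ k) y + (R ^ (-k)) y = t • y) (y : Lattice) :
    (R ^ (2 * k)) y + (R ^ (-(2 * k))) y = (t ^ 2 - 2) • y := by
  have h1 := h ((R ^ k) y)
  have h2 := h ((R ^ (-k)) y)
  have h3 := h y
  simp only [← zpow_add_apply, neg_add_cancel, add_neg_cancel, zpow_zero, LinearEquiv.coe_one, id_eq]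
    at h1 h2
  rw [two_mul, neg_add, sub_smul, pow_two, mul_smul, ← h3, smul_add, ← h1, ← h2]
  module

/-- The relation is Cayley–Hamilton, with `d = ±1` by invertibility. If `d = 1` and `|t| ≤ 2`, then
`t / 2 + i √(1 - t² / 4)` is an eigenvalue on the unit circle; if `d = -1` and `t = 0`, then `1` is
one. -/
theorem trace_det_of_hyperbolic (R : Lattice ≃+ Lattice) (hR : IsHyperbolic R) :
    ∃ t d : ℤ, (∀ y, R (R y) - t • R y + d • y = 0) ∧
      ((d = 1 ∧ 9 ≤ t ^ 2) ∨ (d = -1 ∧ 1 ≤ t ^ 2)) := by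
  set L := R.toAddMonoidHom.toIntLinearMap with hL
  set A := LinearMap.toMatrix' L with hA
  have hchar : L.charpoly = Polynomial.X ^ 2 - Polynomial.C A.trace * Polynomial.X
      + Polynomial.C A.det := by
    rw [← Matrix.charpoly_fin_two, ← Matrix.charpoly_toLin', hA, Matrix.toLin'_toMatrix']
  have hdet : A.det = 1 ∨ A.det = -1 := by
    rw [← Int.isUnit_iff, hA, LinearMap.det_toMatrix']
    exact (R.toIntLinearEquiv).isUnit_det'
  refine ⟨A.trace, A.det, fun y => ?_, ?_⟩
  · have := LinearMap.congr_fun (LinearMap.aeval_self_charpoly L) y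
    rw [hchar] at this
    simpa [pow_two, hL] using this
  · have hz : ∀ z : ℂ, z ^ 2 - A.trace * z + A.det = 0 → ‖z‖ ≠ 1 := by
      intro z h
      apply hR z
      rw [← hL, hchar]
      simpa using h
    rcases hdet with hd | hd
    · left
      refine ⟨hd, ?_⟩
      by_contra! hlt
      have h4 : A.trace ^ 2 ≤ 4 := by
        have : |A.trace| < 3 := by
          apply abs_lt_of_sq_lt_sq _ (by norm_num)
          linarith
        have h2 : |A.trace| ≤ 2 := by omega
        have := sq_le_sq' (neg_le_of_abs_le h2) (le_of_abs_le h2)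
        linarith
      have h4' : (A.trace : ℝ) ^ 2 ≤ 4 := by exact_mod_cast h4
      set t : ℝ := (A.trace : ℝ) with ht
      have hs : Real.sqrt (1 - t ^ 2 / 4) ^ 2 = 1 - t ^ 2 / 4 := Real.sq_sqrt (by linarith)
      set s := Real.sqrt (1 - t ^ 2 / 4)
      refine hz ⟨t / 2, s⟩ ?_ ?_
      · rw [hd]
        have e : ((A.trace : ℤ) : ℂ) = (t : ℂ) := by simp [ht]
        rw [e]
        apply Complex.ext
        · simp [pow_two]
          nlinarith
        · simp [pow_two]
          ring
      · rw [← sq_eq_sq₀ (norm_nonneg _) zero_le_one, Complex.sq_norm, Complex.normSq_mk]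
        nlinarith
    · right
      refine ⟨hd, ?_⟩
      by_contra! hlt
      have h0 : A.trace = 0 := by
        by_contra h
        have := pow_pos (abs_pos.2 h) 2
        rw [sq_abs] at this
        linarith
      refine hz 1 ?_ (by simp)
      rw [hd, h0]
      norm_num

/-- The traces of `R ^ 2`, `R ^ 4`, `R ^ 8` are at least `3`, `7`, `47`. The eighth power is taken
because the saving `τ - 2` must outweigh the cost `2 * 16` of widening an interval by `8` at both
ends. -/
theorem exists_hasTrace (R : Lattice ≃+ Lattice) (hR : IsHyperbolic R) :
    ∃ τ : ℤ, 47 ≤ τ ∧ HasTrace R.toIntLinearEquiv τ := by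
  obtain ⟨t, d, hCH, ht⟩ := trace_det_of_hyperbolic R hR
  let S : Aut := R.toIntLinearEquiv
  have hS : ∀ y, S y = R y := fun _ => rfl
  have hdd : d * d = 1 := by rcases ht with ⟨rfl, -⟩ | ⟨rfl, -⟩ <;> norm_num
  have h1 : ∀ y : Lattice, (S ^ (1 : ℤ)) y + d • (S ^ (-1 : ℤ)) y = t • y := by
    intro y
    have h := hCH ((S ^ (-1 : ℤ)) y)
    have e : R ((S ^ (-1 : ℤ)) y) = y := by
      rw [← hS, zpow_neg_one]
      exact AddEquiv.apply_symm_apply R y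
    rw [e] at h
    rw [zpow_one, hS]
    rw [← sub_eq_zero, ← h]
    abel
  have h2 : ∀ y : Lattice, (S ^ (2 : ℤ)) y + (S ^ (-2 : ℤ)) y = (t ^ 2 - 2 * d) • y := by
    intro y
    have g1 := h1 ((S ^ (1 : ℤ)) y)
    have g2 := h1 ((S ^ (-1 : ℤ)) y)
    simp only [← zpow_add_apply, show (1 : ℤ) + 1 = 2 from rfl, show (-1 : ℤ) + 1 = 0 from rfl,
      show (1 : ℤ) + -1 = 0 from rfl, show (-1 : ℤ) + -1 = -2 from rfl, zpow_zero,
      LinearEquiv.coe_one, id_eq] at g1 g2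
    rw [sub_smul, pow_two, mul_smul, ← h1 y, smul_add, smul_comm t d, ← g1, ← g2]
    have : (S ^ (-2 : ℤ)) y = (d * d) • (S ^ (-2 : ℤ)) y := by rw [hdd, one_smul]
    conv_lhs => rw [this]
    module
  have h4 := trace_double S 2 _ h2
  have h8 := trace_double S (2 * 2) _ h4
  refine ⟨((t ^ 2 - 2 * d) ^ 2 - 2) ^ 2 - 2, ?_, h8⟩
  have hT : 3 ≤ t ^ 2 - 2 * d := by rcases ht with ⟨rfl, h⟩ | ⟨rfl, h⟩ <;> linarith
  have hT4 : 7 ≤ (t ^ 2 - 2 * d) ^ 2 - 2 := by nlinarith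
  nlinarith

/-! ### Tails of a family -/

/-- The tail `∑_{i ≥ j} R ^ (i - j) (f i)` of the evaluation of a family. -/
noncomputable def tail (R : Aut) (f : Fam) (j : ℤ) : Lattice :=
  (R ^ (-j)) (ev R (f.filter (j ≤ ·)))

theorem zpow_tail (R : Aut) (f : Fam) (j : ℤ) :
    (R ^ j) (tail R f j) = ev R (f.filter (j ≤ ·)) := by
  simp only [tail, ← zpow_add_apply, add_neg_cancel, zpow_zero, LinearEquiv.coe_one, id_eq]

theorem tail_step (R : Aut) (f : Fam) (j : ℤ) : tail R f j - R (tail R f (j + 1)) = f j := by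
  have h : f.filter (j ≤ ·) = Finsupp.single j (f j) + f.filter (j + 1 ≤ ·) := by
    ext1 i
    rw [Finsupp.add_apply, Finsupp.filter_apply, Finsupp.filter_apply, Finsupp.single_apply]
    rcases lt_trichotomy i j with hi | rfl | hi
    · rw [if_neg (by omega), if_neg (by omega), if_neg (by omega), zero_add]
    · simp
    · rw [if_pos (by omega), if_neg (by omega), if_pos (by omega), zero_add]
  have e : R (tail R f (j + 1)) = (R ^ (-j)) (ev R (f.filter (j + 1 ≤ ·))) := by
    have h1 : ∀ y, R y = (R ^ (1 : ℤ)) y := fun y => by rw [zpow_one]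
    rw [h1, tail, ← zpow_add_apply]
    congr 3
    ring
  rw [e, tail, h, map_add, map_add, ev_single, ← zpow_add_apply]
  simp

theorem tail_sub (R : Aut) (f g : Fam) (j : ℤ) : tail R (f - g) j = tail R f j - tail R g j := by
  simp [tail, Finsupp.filter_sub]

theorem tail_eq_zero (R : Aut) {f : Fam} {j : ℤ} (h : ∀ i, j ≤ i → f i = 0) : tail R f j = 0 := by
  have : f.filter (j ≤ ·) = 0 := Finsupp.filter_eq_zero_iff _ _ |>.2 h
  simp [tail, this]

theorem tail_eq_zero_of_ev (R : Aut) {f : Fam} {j : ℤ} (hf : ev R f = 0)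
    (h : ∀ i, f i ≠ 0 → j ≤ i) : tail R f j = 0 := by
  have : f.filter (j ≤ ·) = f := Finsupp.filter_eq_self_iff _ _ |>.2 h
  simp [tail, this, hf]

theorem exists_support_bound (f : Fam) : ∃ b : ℤ, ∀ i, f i ≠ 0 → |i| ≤ b := by
  refine ⟨∑ i ∈ f.support, |i|, fun i hi => ?_⟩
  exact Finset.single_le_sum (f := fun i : ℤ => |i|) (fun _ _ => abs_nonneg _)
    (Finsupp.mem_support_iff.2 hi)

/-- Tails vanish to the right of the support, and also to its left, where the tail is a power of `R`
applied to the full evaluation. -/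
theorem finite_range_tail (R : Aut) {f : Fam} (hf : ev R f = 0) :
    (Set.range (tail R f)).Finite := by
  obtain ⟨b, hb⟩ := exists_support_bound f
  refine (((Set.finite_Icc (-b) b).image (tail R f)).union (Set.finite_singleton 0)).subset ?_
  rintro _ ⟨j, rfl⟩
  by_cases hj : j ∈ Set.Icc (-b) b
  · exact Or.inl ⟨j, hj, rfl⟩
  · right
    rw [Set.mem_Icc, not_and_or, not_le, not_le] at hj
    rcases hj with hj | hj
    · exact tail_eq_zero_of_ev R hf fun i hi => by have := abs_le.1 (hb i hi); omega
    · refine tail_eq_zero R fun i hi => ?_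
      by_contra h
      have := abs_le.1 (hb i h)
      omega

/-- A maximum principle: a bounded sequence that almost satisfies the recursion
`x (j - 8) + x (j + 8) = τ x j` is small. -/
theorem nrm_le_of_recursion {τ E : ℤ} (hτ : 3 ≤ τ) {x : ℤ → Lattice} (hx : (Set.range x).Finite)
    (h : ∀ j, nrm (x (j - 8) + x (j + 8) - τ • x j) ≤ E) (j : ℤ) : nrm (x j) ≤ E := by
  -- At an index `k` of maximal norm, `τ * nrm (x k) ≤ 2 * nrm (x k) + E`, and `τ ≥ 3`.
  obtain ⟨_, ⟨k, rfl⟩, hk⟩ := Set.exists_max_image _ nrm hx ⟨x 0, 0, rfl⟩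
  have hk' : ∀ i, nrm (x i) ≤ nrm (x k) := fun i => hk _ ⟨i, rfl⟩
  have e : τ • x k = (x (k - 8) + x (k + 8)) - (x (k - 8) + x (k + 8) - τ • x k) := by abel
  have h1 : τ * nrm (x k) ≤ nrm (x (k - 8)) + nrm (x (k + 8)) + E := by
    have := nrm_zsmul τ (x k)
    rw [abs_of_nonneg (by linarith)] at this
    rw [← this, e]
    have := nrm_sub_le (x (k - 8) + x (k + 8)) (x (k - 8) + x (k + 8) - τ • x k)
    have := nrm_add_le (x (k - 8)) (x (k + 8))
    have := h k
    linarith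
  have h2 := hk' (k - 8)
  have h3 := hk' (k + 8)
  have h4 := mul_le_mul_of_nonneg_right hτ (nrm_nonneg (x k))
  have h5 := hk' j
  linarith

/-- Telescoping the one-step error over `k` steps; the bound is uniform in the sequence. -/
theorem exists_step_bound (R : Aut) (δ : ℤ) (k : ℕ) :
    ∃ E : ℤ, ∀ x : ℤ → Lattice, (∀ j, nrm (x j - R (x (j + 1))) ≤ δ) →
      ∀ j, nrm (x j - (R ^ (k : ℤ)) (x (j + k))) ≤ E := by
  induction k with
  | zero => exact ⟨0, fun x _ j => by simp⟩
  | succ k ih =>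
    obtain ⟨E, hE⟩ := ih
    obtain ⟨r, hr, hr'⟩ := exists_nrm_map_le (R ^ (k : ℤ)).toLinearMap.toAddMonoidHom
    refine ⟨E + r * δ, fun x hx j => ?_⟩
    have e : x j - (R ^ ((k + 1 : ℕ) : ℤ)) (x (j + (k + 1 : ℕ))) =
        (x j - (R ^ (k : ℤ)) (x (j + k))) + (R ^ (k : ℤ)) (x (j + k) - R (x (j + k + 1))) := by
      have h1 : (R ^ ((k + 1 : ℕ) : ℤ)) (x (j + (k + 1 : ℕ))) =
          (R ^ (k : ℤ)) (R (x (j + k + 1))) := by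
        push_cast
        rw [zpow_add_apply, zpow_one, add_assoc]
      rw [h1, map_sub]
      abel
    rw [e]
    refine (nrm_add_le _ _).trans (add_le_add (hE x hx j) ?_)
    exact (hr' _).trans (mul_le_mul_of_nonneg_left (hx _) hr)

/-- The tails of a family with bounded entries and evaluation zero are bounded. -/
theorem exists_tail_bound (R : Aut) {τ : ℤ} (hτ : 3 ≤ τ) (hR : HasTrace R τ) (δ : ℤ) :
    ∃ K : ℤ, ∀ f : Fam, ev R f = 0 → (∀ i, nrm (f i) ≤ δ) → ∀ j, nrm (tail R f j) ≤ K := by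
  obtain ⟨E, hE⟩ := exists_step_bound R δ 8
  obtain ⟨r, hr, hr'⟩ := exists_nrm_map_le (R ^ (-8 : ℤ)).toLinearMap.toAddMonoidHom
  refine ⟨E + r * E, fun f hf hδ => ?_⟩
  refine nrm_le_of_recursion hτ (finite_range_tail R hf) fun j => ?_
  have hE' := hE (tail R f) fun j => by rw [tail_step]; exact hδ j
  set x := tail R f
  have h1 := hE' (j - 8)
  have h2 := hE' j
  simp only [Nat.cast_ofNat, sub_add_cancel] at h1 h2
  -- Substituting `τ • x j = R ^ 8 (x j) + R ^ (-8) (x j)` leaves two eight-step errors.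
  have e : x (j - 8) + x (j + 8) - τ • x j =
      (x (j - 8) - (R ^ (8 : ℤ)) (x j)) - (R ^ (-8 : ℤ)) (x j - (R ^ (8 : ℤ)) (x (j + 8))) := by
    rw [← hR, map_sub, ← zpow_add_apply]
    simp only [neg_add_cancel, zpow_zero, LinearEquiv.coe_one, id_eq]
    abel
  rw [e]
  refine (nrm_sub_le _ _).trans (add_le_add h1 ?_)
  exact (hr' _).trans (mul_le_mul_of_nonneg_left h2 hr)

/-- The orbit of a periodic vector is finite and satisfies the recursion exactly, so the maximum
principle applies with `E = 0`. -/
theorem eq_zero_of_zpow_fixed (R : Aut) {τ : ℤ} (hτ : 3 ≤ τ) (hR : HasTrace R τ) {p : ℤ}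
    (hp : 0 < p) {x : Lattice} (hx : (R ^ p) x = x) : x = 0 := by
  have hq : ∀ q : ℤ, (R ^ (p * q)) x = x := fun q => by
    rw [zpow_mul]
    exact Subgroup.zpow_mem (MulAction.stabilizer Aut x) hx q
  have hfin : (Set.range fun l : ℤ => (R ^ l) x).Finite := by
    refine ((Set.finite_Ico 0 p).image fun l : ℤ => (R ^ l) x).subset ?_
    rintro _ ⟨l, rfl⟩
    refine ⟨l % p, ⟨Int.emod_nonneg _ hp.ne', Int.emod_lt_of_pos _ hp⟩, ?_⟩
    conv_rhs => rw [← Int.emod_add_mul_ediv l p]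
    simp only [zpow_add_apply, hq]
  have := nrm_le_of_recursion (E := 0) hτ hfin (fun j => ?_) 0
  · exact nrm_eq_zero (by simpa using this)
  · rw [← hR, sub_eq_neg_add j, add_comm j 8]
    simp only [zpow_add_apply]
    rw [add_comm, sub_self, nrm_zero]

/-! ### Families of minimal size -/

/-- `f` has minimal size among the families with the same evaluation. -/
def IsMinFam (R : Aut) (f : Fam) : Prop := ∀ g : Fam, ev R g = ev R f → size f ≤ size g

/-- A cheaper replacement for a part of `f`, added to the rest, would be a cheaper replacement for
`f`. -/
theorem IsMinFam.filter {R : Aut} {f : Fam} (hf : IsMinFam R f) (p : ℤ → Prop) [DecidablePred p] :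
    IsMinFam R (f.filter p) := by
  intro g hg
  have h1 := hf (g + f.filter fun i => ¬ p i) (by
    rw [map_add, hg, ← map_add, Finsupp.filter_add_filter_not])
  have h2 := size_filter_add f p
  have h3 := size_add_le g (f.filter fun i => ¬ p i)
  linarith

/-- A minimal family vanishes beyond any two equal tails. -/
theorem IsMinFam.eq_zero_of_tail_eq {R : Aut} {τ : ℤ} (hτ : 3 ≤ τ) (hR : HasTrace R τ) {f : Fam}
    (hf : IsMinFam R f) {j k : ℤ} (hjk : j < k) (h : tail R f j = tail R f k) {i : ℤ}
    (hi : j ≤ i) : f i = 0 := by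
  have hj := zpow_tail R f j
  have hk := zpow_tail R f k
  rw [← h] at hk
  have hmin := hf.filter (j ≤ ·)
  -- Since the tails agree, the part from `k` on, shifted by `j - k`, has the evaluation of the part
  -- from `j` on.
  have hle : size (f.filter (j ≤ ·)) ≤ size (f.filter (k ≤ ·)) := by
    rw [← size_mapDomain (add_right_injective (j - k)) (f.filter (k ≤ ·))]
    refine hmin _ ?_
    rw [ev_mapDomain_add, ← hk, ← hj, ← zpow_add_apply, sub_add_cancel]
  have hfil : (f.filter (j ≤ ·)).filter (k ≤ ·) = f.filter (k ≤ ·) := by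
    ext1 i
    simp only [Finsupp.filter_apply]
    by_cases h : k ≤ i
    · simp only [h, if_true, hjk.le.trans h]
    · simp only [h, if_false]
  -- Hence nothing of `f` lies in `[j, k)`.
  have hz : (f.filter (j ≤ ·)).filter (fun i => ¬ k ≤ i) = 0 := by
    apply eq_zero_of_size_le
    have := size_filter_add (f.filter (j ≤ ·)) (k ≤ ·)
    rw [hfil] at this
    linarith
  have heq : f.filter (j ≤ ·) = f.filter (k ≤ ·) := by
    rw [← Finsupp.filter_add_filter_not (f.filter (j ≤ ·)) (k ≤ ·), hz, hfil, add_zero]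
  -- The common tail is now fixed by `R ^ (k - j)`.
  have hx : tail R f j = 0 := by
    refine eq_zero_of_zpow_fixed R hτ hR (sub_pos.2 hjk) ?_
    rw [sub_eq_neg_add, zpow_add_apply, hk, ← heq]
    rfl
  have h0 : f.filter (j ≤ ·) = 0 := by
    apply eq_zero_of_size_le
    refine (hmin 0 ?_).trans size_zero.le
    rw [← hj, hx, map_zero, map_zero]
  have := DFunLike.congr_fun h0 i
  rwa [Finsupp.filter_apply, if_pos hi] at this

/-- On the right, the support of a minimal family does not go far beyond that of any other family
with the same evaluation and bounded entries. -/
theorem exists_right_bound (R : Aut) {τ : ℤ} (hτ : 3 ≤ τ) (hR : HasTrace R τ) (β : ℤ) :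
    ∃ C : ℕ, ∀ (f g : Fam) (M : ℤ), IsMinFam R f → ev R g = ev R f → (∀ i, nrm (f i) ≤ β) →
      (∀ i, nrm (g i) ≤ β) → (∀ i, g i ≠ 0 → i ≤ M) → ∀ i, f i ≠ 0 → i ≤ M + C := by
  obtain ⟨K, hK⟩ := exists_tail_bound R hτ hR (β + β)
  -- The overshoot is at most the number of possible tails, the lattice points of norm at most `K`.
  refine ⟨(finite_nrm_le K).toFinset.card, fun f g M hf hfg hfβ hgβ hg i hi => ?_⟩
  set s := (finite_nrm_le K).toFinset with hs
  have hd := hK (f - g) (by rw [map_sub, hfg, sub_self])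
    fun i => (nrm_sub_le _ _).trans (add_le_add (hfβ i) (hgβ i))
  have hmem : ∀ k ∈ Finset.range (s.card + 1), tail R f (M + 1 + k) ∈ s := by
    intro k _
    rw [hs, Set.Finite.mem_toFinset]
    have := hd (M + 1 + k)
    rw [tail_sub, tail_eq_zero R (f := g), sub_zero] at this
    · exact this
    · intro i hi
      by_contra h
      have := hg i h
      omega
  obtain ⟨k, hk, l, hl, hkl, heq⟩ :=
    Finset.exists_ne_map_eq_of_card_lt_of_maps_to (by simp) hmem
  rw [Finset.mem_range] at hk hl
  by_contra! hlt
  rcases lt_or_gt_of_ne hkl with h | h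
  · exact hi (hf.eq_zero_of_tail_eq hτ hR (by omega) heq (by omega))
  · exact hi (hf.eq_zero_of_tail_eq hτ hR (by omega) heq.symm (by omega))

theorem mapDomain_neg_apply (f : Fam) (i : ℤ) : f.mapDomain Neg.neg i = f (-i) := by
  conv_lhs => rw [← neg_neg i]
  exact Finsupp.mapDomain_apply neg_injective f (-i)

theorem IsMinFam.reflect {R : Aut} {f : Fam} (hf : IsMinFam R f) :
    IsMinFam R⁻¹ (f.mapDomain Neg.neg) := by
  intro g hg
  rw [ev_mapDomain_neg] at hg
  rw [size_mapDomain neg_injective, ← size_mapDomain neg_injective g]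
  apply hf
  rw [← hg, ← ev_mapDomain_neg R⁻¹, inv_inv]

/-- The left bound is the right bound for the reflected families, with `R⁻¹` in place of `R`. -/
theorem exists_support_near (R : Aut) {τ : ℤ} (hτ : 3 ≤ τ) (hR : HasTrace R τ) (β : ℤ) :
    ∃ C : ℕ, ∀ (f g : Fam) (m M : ℤ), IsMinFam R f → ev R g = ev R f → (∀ i, nrm (f i) ≤ β) →
      (∀ i, nrm (g i) ≤ β) → (∀ i, g i ≠ 0 → m ≤ i ∧ i ≤ M) →
      ∀ i, f i ≠ 0 → m - C ≤ i ∧ i ≤ M + C := by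
  obtain ⟨C₁, h₁⟩ := exists_right_bound R hτ hR β
  obtain ⟨C₂, h₂⟩ := exists_right_bound R⁻¹ hτ hR.inv β
  refine ⟨max C₁ C₂, fun f g m M hf hfg hfβ hgβ hg i hi => ?_⟩
  have a := h₁ f g M hf hfg hfβ hgβ (fun i hi => (hg i hi).2) i hi
  have b := h₂ (f.mapDomain Neg.neg) (g.mapDomain Neg.neg) (-m) hf.reflect
    (by rw [ev_mapDomain_neg, ev_mapDomain_neg, hfg])
    (fun i => by rw [mapDomain_neg_apply]; exact hfβ _)
    (fun i => by rw [mapDomain_neg_apply]; exact hgβ _)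
    (fun i hi => by rw [mapDomain_neg_apply] at hi; have := (hg _ hi).1; omega)
    (-i) (by rw [mapDomain_neg_apply, neg_neg]; exact hi)
  push_cast
  omega

/-! ### Rewriting a family with a large entry -/

theorem exists_rewrite (R : Aut) {τ : ℤ} (hτ : 3 ≤ τ) (hR : HasTrace R τ) (f : Fam) (i : ℤ)
    (hi : 2 * τ ≤ nrm (f i)) :
    ∃ g : Fam, ev R g = ev R f ∧ size g + τ ≤ size f + 2 ∧
      ∀ m M : ℤ, (∀ j, f j ≠ 0 → m ≤ j ∧ j ≤ M) → ∀ j, g j ≠ 0 → m - 8 ≤ j ∧ j ≤ M + 8 := by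
  -- One of the two coordinates has absolute value at least `τ`; `z` is the signed unit vector
  -- pointing along it.
  obtain ⟨z, hz1, hz⟩ : ∃ z : Lattice, nrm z = 1 ∧ nrm (f i - τ • z) = nrm (f i) - τ := by
    have hs : |f i 0| + |f i 1| = nrm (f i) := rfl
    have key : ∀ x : ℤ, τ ≤ |x| → ∃ e : ℤ, |e| = 1 ∧ |x - τ * e| = |x| - τ := by
      intro x hx
      rcases abs_cases x with ⟨h1, h2⟩ | ⟨h1, h2⟩
      · refine ⟨1, by simp, ?_⟩
        rw [mul_one, abs_of_nonneg (by linarith), h1]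
      · refine ⟨-1, by simp, ?_⟩
        rw [abs_of_nonpos (by linarith), h1]
        ring
    by_cases h0 : τ ≤ |f i 0|
    · obtain ⟨e, he, he'⟩ := key _ h0
      refine ⟨Pi.single 0 e, by simp [nrm, he], ?_⟩
      simp [nrm, he']
      ring
    · obtain ⟨e, he, he'⟩ := key (f i 1) (by linarith)
      refine ⟨Pi.single 1 e, by simp [nrm, he], ?_⟩
      simp [nrm, he']
      ring
  refine ⟨f.erase i + Finsupp.single i (f i - τ • z) +
    (Finsupp.single (8 + i) z + Finsupp.single (-8 + i) z), ?_, ?_, ?_⟩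
  · have h := hR ((R ^ i) z)
    have hf : ev R f = ev R (Finsupp.single i (f i)) + ev R (f.erase i) := by
      rw [← map_add, Finsupp.single_add_erase]
    rw [hf]
    simp only [map_add, ev_single, zpow_add_apply, h, map_sub, map_zsmul]
    abel
  · have h1 := nrm_add_size_erase f i
    have h2 := size_add_le (f.erase i + Finsupp.single i (f i - τ • z))
      (Finsupp.single (8 + i) z + Finsupp.single (-8 + i) z)
    have h3 := size_add_le (f.erase i) (Finsupp.single i (f i - τ • z))
    have h4 := size_add_le (Finsupp.single (8 + i) z) (Finsupp.single (-8 + i) z)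
    simp only [size_single] at h3 h4
    linarith
  · intro m M h j hj
    have hi0 := h i (fun h0 => by rw [h0, nrm_zero] at hi; linarith)
    by_cases hfj : f j = 0
    · by_contra hcon
      apply hj
      simp only [Finsupp.add_apply, Finsupp.single_apply]
      rw [if_neg (by omega), if_neg (by omega), if_neg (by omega)]
      have : f.erase i j = 0 := by
        rw [Finsupp.erase_apply]; split_ifs <;> simp [hfj]
      simp [this]
    · have := h j hfj
      omega

/-- Otherwise rewriting would save at least `τ - 2 > 0`. -/
theorem IsMinFam.nrm_lt {R : Aut} {τ : ℤ} (hτ : 3 ≤ τ) (hR : HasTrace R τ) {f : Fam}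
    (hf : IsMinFam R f) (i : ℤ) : nrm (f i) < 2 * τ := by
  by_contra! h
  obtain ⟨g, hg, hs, -⟩ := exists_rewrite R hτ hR f i h
  have := hf g hg
  linarith

/-- Every family can be replaced by one with bounded entries, at no cost. -/
theorem exists_bounded_fam (R : Aut) {τ : ℤ} (hτ : 47 ≤ τ) (hR : HasTrace R τ) (s : ℕ) :
    ∀ (f : Fam) (m M : ℤ), size f ≤ s → (∀ j, f j ≠ 0 → m ≤ j ∧ j ≤ M) →
      ∃ (g : Fam) (m' M' : ℤ), ev R g = ev R f ∧ (∀ i, nrm (g i) ≤ 2 * τ) ∧ m' ≤ m ∧ M ≤ M' ∧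
        (∀ j, g j ≠ 0 → m' ≤ j ∧ j ≤ M') ∧
        size g + 2 * (M' - m') ≤ size f + 2 * (M - m) := by
  induction s using Nat.strong_induction_on with
  | _ s ih =>
    intro f m M hs hf
    by_cases hb : ∀ i, nrm (f i) ≤ 2 * τ
    · exact ⟨f, m, M, rfl, hb, le_rfl, le_rfl, hf, le_rfl⟩
    · push Not at hb
      obtain ⟨i, hi⟩ := hb
      -- The size drops by at least `45`, while widening the interval by `8` at each end costs `32`.
      obtain ⟨g, hg, hgs, hsupp⟩ := exists_rewrite R (by linarith) hR f i hi.le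
      have h0 := size_nonneg g
      obtain ⟨g', m', M', h1, h2, h3, h4, h5, h6⟩ :=
        ih (size g).toNat (by omega) g (m - 8) (M + 8) (by omega) (hsupp m M hf)
      exact ⟨g', m', M', h1.trans hg, h2, by omega, by omega, h5, by omega⟩

/-! ### Families and the abelianization of `N` -/

/-- The homomorphism that sends a family `f` to the product of the classes of
`conjA i ^ (f i 0) * conjB i ^ (f i 1)`. -/
noncomputable def toNabHom : Fam →+ Additive Nab :=
  Finsupp.liftAddHom fun i : ℤ =>
    { toFun := fun y => Additive.ofMul
        (Abelianization.of (conjA i) ^ y 0 * Abelianization.of (conjB i) ^ y 1)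
      map_zero' := by simp
      map_add' := fun y z => by
        rw [← ofMul_mul]
        congr 1
        simp only [Pi.add_apply, zpow_add]
        exact mul_mul_mul_comm _ _ _ _ }

/-- The element of `N_ab` given by a family. -/
noncomputable def toNab (f : Fam) : Nab := (toNabHom f).toMul

@[simp] theorem toNab_zero : toNab 0 = 1 := by simp [toNab]

theorem toNab_add (f g : Fam) : toNab (f + g) = toNab f * toNab g := by simp [toNab]

theorem toNab_neg (f : Fam) : toNab (-f) = (toNab f)⁻¹ := by simp [toNab]

theorem toNab_single (i : ℤ) (y : Lattice) : toNab (Finsupp.single i y) =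
    Abelianization.of (conjA i) ^ y 0 * Abelianization.of (conjB i) ^ y 1 := by
  simp [toNab, toNabHom]

theorem action_apply (R : Lattice ≃+ Lattice) (i : ℤ) (y : Lattice) :
    action R (Multiplicative.ofAdd i) (Multiplicative.ofAdd y) =
      Multiplicative.ofAdd ((R.toIntLinearEquiv ^ i) y) := by
  rw [action, zpowersHom_apply, toAdd_ofAdd]
  induction i using Int.induction_on generalizing y with
  | zero => simp
  | succ i ih =>
    rw [zpow_add_one, zpow_add_one, MulAut.mul_apply, LinearEquiv.mul_apply, ← ih]
    rfl
  | pred i ih =>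
    rw [zpow_sub_one, zpow_sub_one, MulAut.mul_apply, LinearEquiv.mul_apply, ← ih]
    rfl

theorem proj_conj (R : Lattice ≃+ Lattice) (i : ℤ) (s : Gen) (y : Lattice)
    (hs : gen R s = SemidirectProduct.inl (Multiplicative.ofAdd y)) :
    sigma R (cPow i * FreeGroup.of s * (cPow i)⁻¹) =
      SemidirectProduct.inl (Multiplicative.ofAdd ((R.toIntLinearEquiv ^ i) y)) := by
  rw [map_mul, map_mul, map_inv, sigma_cPow, ← action_apply, SemidirectProduct.inl_aut]
  simp [sigma, hs]

theorem proj_toNab (R : Lattice ≃+ Lattice) (f : Fam) :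
    proj R (toNab f) = Multiplicative.ofAdd (ev R.toIntLinearEquiv f) := by
  induction f using Finsupp.induction_linear with
  | zero => simp
  | add f g hf hg => rw [toNab_add, map_mul, hf, hg, map_add, ofAdd_add]
  | single i y =>
    have ha : proj R (Abelianization.of (conjA i)) =
        Multiplicative.ofAdd ((R.toIntLinearEquiv ^ i) (Pi.single 0 1)) :=
      SemidirectProduct.inl_injective
        ((inl_proj_of R _).trans (proj_conj R i Gen.a (Pi.single 0 1) rfl))
    have hb : proj R (Abelianization.of (conjB i)) =
        Multiplicative.ofAdd ((R.toIntLinearEquiv ^ i) (Pi.single 1 1)) :=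
      SemidirectProduct.inl_injective
        ((inl_proj_of R _).trans (proj_conj R i Gen.b (Pi.single 1 1) rfl))
    have hy : y = y 0 • Pi.single 0 1 + y 1 • Pi.single 1 1 := by
      funext i; fin_cases i <;> simp
    rw [toNab_single, map_mul, map_zpow, map_zpow, ha, hb, ev_single]
    conv_rhs => rw [hy, map_add, map_zsmul, map_zsmul]
    rfl

/-! ### Lengths in the abelianization -/

theorem len_prod_le (L : List Nab) (hL : ∀ x ∈ L, x ∈ T ∨ x⁻¹ ∈ T) : len L.prod ≤ L.length :=
  Nat.sInf_le ⟨L, hL, rfl, rfl⟩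

theorem len_mul_le (v w : Nab) : len (v * w) ≤ len v + len w := by
  obtain ⟨L, hL, hv, hl⟩ := exists_word_len v
  obtain ⟨L', hL', hw, hl'⟩ := exists_word_len w
  have := len_prod_le (L ++ L') fun x hx =>
    (List.mem_append.1 hx).elim (hL x) (hL' x)
  rwa [List.prod_append, List.length_append, hv, hw, hl, hl'] at this

theorem len_zpow_le {t : Nab} (ht : t ∈ T) (k : ℤ) : (len (t ^ k) : ℤ) ≤ |k| := by
  rw [Int.abs_eq_natAbs, Int.ofNat_le]
  rcases Int.natAbs_eq k with h | h
  · have := len_prod_le (List.replicate k.natAbs t) fun x hx =>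
      Or.inl (by rwa [List.eq_of_mem_replicate hx])
    rw [List.prod_replicate, List.length_replicate, ← zpow_natCast] at this
    rwa [← h] at this
  · have := len_prod_le (List.replicate k.natAbs t⁻¹) fun x hx =>
      Or.inr (by rwa [List.eq_of_mem_replicate hx, inv_inv])
    rw [List.prod_replicate, List.length_replicate, ← zpow_natCast, inv_zpow', ← h] at this
    exact this

theorem len_toNab_le (f : Fam) : (len (toNab f) : ℤ) ≤ size f := by
  induction f using Finsupp.induction with
  | zero =>
    rw [toNab_zero, size_zero]
    exact_mod_cast len_prod_le [] (by simp)
  | single_add i y f hi hy ih =>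
    have h1 := nrm_add_size_erase (Finsupp.single i y + f) i
    have h2 : f i = 0 := Finsupp.notMem_support_iff.1 hi
    rw [Finsupp.erase_add, Finsupp.erase_single, zero_add, Finsupp.erase_of_notMem_support hi,
      Finsupp.add_apply, Finsupp.single_eq_same, h2, add_zero] at h1
    rw [← h1, toNab_add, toNab_single]
    have h3 := len_mul_le (Abelianization.of (conjA i) ^ y 0 * Abelianization.of (conjB i) ^ y 1)
      (toNab f)
    have h4 := len_mul_le (Abelianization.of (conjA i) ^ y 0) (Abelianization.of (conjB i) ^ y 1)
    have h5 := len_zpow_le (t := Abelianization.of (conjA i)) ⟨i, Or.inl rfl⟩ (y 0)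
    have h6 := len_zpow_le (t := Abelianization.of (conjB i)) ⟨i, Or.inr rfl⟩ (y 1)
    unfold nrm
    omega

theorem exists_fam_of_mem_T {t : Nab} (ht : t ∈ T) : ∃ f : Fam, toNab f = t ∧ size f = 1 := by
  obtain ⟨i, rfl | rfl⟩ := ht
  · exact ⟨Finsupp.single i (Pi.single 0 1), by simp [toNab_single], by simp [nrm]⟩
  · exact ⟨Finsupp.single i (Pi.single 1 1), by simp [toNab_single], by simp [nrm]⟩

theorem size_neg (f : Fam) : size (-f) = size f := by
  unfold size
  rw [Finsupp.sum_neg_index fun _ => nrm_zero]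
  simp

theorem exists_fam_of_list (L : List Nab) (hL : ∀ x ∈ L, x ∈ T ∨ x⁻¹ ∈ T) :
    ∃ f : Fam, toNab f = L.prod ∧ size f ≤ L.length := by
  induction L with
  | nil => exact ⟨0, by simp, by simp⟩
  | cons t L ih =>
    obtain ⟨f, hf, hs⟩ := ih fun x hx => hL x (List.mem_cons_of_mem _ hx)
    obtain ⟨e, he, hes⟩ : ∃ e : Fam, toNab e = t ∧ size e = 1 := by
      rcases hL t List.mem_cons_self with h | h
      · exact exists_fam_of_mem_T h
      · obtain ⟨e, he, hes⟩ := exists_fam_of_mem_T h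
        exact ⟨-e, by rw [toNab_neg, he, inv_inv], by rw [size_neg, hes]⟩
    refine ⟨e + f, by rw [toNab_add, he, hf, List.prod_cons], ?_⟩
    have := size_add_le e f
    rw [List.length_cons]
    push_cast
    linarith

/-- A shortest word for `v` yields a family of size at most `len v`, and no family for `v` can be
smaller. Uniqueness of the family is not needed. -/
theorem exists_fam (v : Nab) : ∃ f : Fam, toNab f = v ∧ size f = len v := by
  obtain ⟨L, hL, hv, hl⟩ := exists_word_len v
  obtain ⟨f, hf, hs⟩ := exists_fam_of_list L hL
  rw [hv] at hf
  rw [hl] at hs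
  refine ⟨f, hf, le_antisymm hs ?_⟩
  rw [← hf]
  exact len_toNab_le f

/-! ### Words and families -/

/-- `w = x * c ^ n` with `x ∈ N`, and the class of `x` is given by the family `f`. -/
def Represents (w : F) (f : Fam) (n : ℤ) : Prop :=
  ∃ x : N, w = x * cPow n ∧ Abelianization.of x = toNab f

theorem Represents.phi_eq {w : F} {f : Fam} {n : ℤ} (h : Represents w f n) :
    phi w = toNab f := by
  obtain ⟨x, rfl, hx⟩ := h
  rw [phi_mul_cPow, hx]

theorem Represents.sigma_eq (R : Lattice ≃+ Lattice) {w : F} {f : Fam} {n : ℤ}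
    (h : Represents w f n) : sigma R w =
      SemidirectProduct.inl (Multiplicative.ofAdd (ev R.toIntLinearEquiv f)) *
        SemidirectProduct.inr (Multiplicative.ofAdd n) := by
  obtain ⟨x, rfl, hx⟩ := h
  rw [map_mul, sigma_cPow, ← proj_toNab, ← hx, inl_proj_of]

theorem cPow_add (m n : ℤ) : cPow (m + n) = cPow m * cPow n := zpow_add _ _ _

theorem Represents.of_cPow (n : ℤ) : Represents (cPow n) 0 n := ⟨1, by simp, by simp⟩

theorem Represents.mul_cPow {w : F} {f : Fam} {n : ℤ} (h : Represents w f n) (k : ℤ) :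
    Represents (w * cPow k) f (n + k) := by
  obtain ⟨x, rfl, hx⟩ := h
  exact ⟨x, by rw [cPow_add, mul_assoc], hx⟩

theorem Represents.mul_a {w : F} {f : Fam} {n : ℤ} (h : Represents w f n) (k : ℤ) :
    Represents (w * FreeGroup.of Gen.a ^ k) (f + Finsupp.single n (Pi.single 0 k)) n := by
  obtain ⟨x, rfl, hx⟩ := h
  refine ⟨x * conjA n ^ k, ?_, ?_⟩
  · simp only [Subgroup.coe_mul, Subgroup.coe_zpow, conjA, conj_zpow]
    simp [mul_assoc]
  · simp [toNab_add, toNab_single, hx]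

theorem Represents.mul_b {w : F} {f : Fam} {n : ℤ} (h : Represents w f n) (k : ℤ) :
    Represents (w * FreeGroup.of Gen.b ^ k) (f + Finsupp.single n (Pi.single 1 k)) n := by
  obtain ⟨x, rfl, hx⟩ := h
  refine ⟨x * conjB n ^ k, ?_, ?_⟩
  · simp only [Subgroup.coe_mul, Subgroup.coe_zpow, conjB, conj_zpow]
    simp [mul_assoc]
  · simp [toNab_add, toNab_single, hx]

/-- Running through a path word backwards. -/
theorem Represents.reverse {w : F} {f : Fam} {m M : ℤ} (h : Represents (cPow m * w) f M) :
    Represents (cPow M * w⁻¹) (-f) m := by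
  obtain ⟨x, hw, hx⟩ := h
  refine ⟨x⁻¹, ?_, by rw [map_inv, hx, toNab_neg]⟩
  have : w = (cPow m)⁻¹ * (x * cPow M) := by rw [← hw, inv_mul_cancel_left]
  rw [this]
  simp [mul_assoc]

/-- A word has at least the length of the shortest path through the support of its family. -/
theorem exists_represents_mk (L : List (Gen × Bool)) :
    ∃ (f : Fam) (n m M : ℤ), Represents (FreeGroup.mk L) f n ∧ m ≤ 0 ∧ m ≤ n ∧ 0 ≤ M ∧ n ≤ M ∧
      (∀ i, f i ≠ 0 → m ≤ i ∧ i ≤ M) ∧ size f + 2 * (M - m) - |n| ≤ L.length := by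
  induction L using List.reverseRecOn with
  | nil => exact ⟨0, 0, 0, 0, Represents.of_cPow 0, by simp⟩
  | append_singleton L s ih =>
    obtain ⟨f, n, m, M, hr, h1, h2, h3, h4, h5, h6⟩ := ih
    obtain ⟨s, e⟩ := s
    obtain ⟨k, hk, hs⟩ : ∃ k : ℤ, |k| = 1 ∧ FreeGroup.mk [(s, e)] = FreeGroup.of s ^ k := by
      cases e
      · exact ⟨-1, by simp, by rw [zpow_neg_one]; rfl⟩
      · exact ⟨1, by simp, by rw [zpow_one]; rfl⟩
    rw [← FreeGroup.mul_mk, hs, List.length_append, List.length_singleton]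
    push_cast
    have hsupp : ∀ y : Lattice, ∀ i, (f + Finsupp.single n y) i ≠ 0 → m ≤ i ∧ i ≤ M := by
      intro y i hi
      by_cases hfi : f i = 0
      · by_cases hni : n = i
        · omega
        · rw [Finsupp.add_apply, hfi, Finsupp.single_apply, if_neg hni, add_zero] at hi
          exact absurd rfl hi
      · exact h5 i hfi
    cases s
    · refine ⟨_, n, m, M, hr.mul_a k, h1, h2, h3, h4, hsupp _, ?_⟩
      have := size_add_le f (Finsupp.single n (Pi.single 0 k))
      have h : nrm (Pi.single 0 k : Lattice) = 1 := by simp [nrm, hk]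
      rw [size_single, h] at this
      linarith
    · refine ⟨_, n, m, M, hr.mul_b k, h1, h2, h3, h4, hsupp _, ?_⟩
      have := size_add_le f (Finsupp.single n (Pi.single 1 k))
      have h : nrm (Pi.single 1 k : Lattice) = 1 := by simp [nrm, hk]
      rw [size_single, h] at this
      linarith
    -- A letter `c` or its inverse moves the endpoint by one. If it leaves `[m, M]`, then `2 * (M -
    -- m)` grows by `2` but `|n|` grows by `1`, so the bound rises by at most `1`.
    · refine ⟨f, n + k, min m (n + k), max M (n + k), hr.mul_cPow k, by omega, by omega, by omega,
        by omega, fun i hi => ?_, ?_⟩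
      · have := h5 i hi
        omega
      · rcases abs_cases k with h | h <;> rcases abs_cases n with h' | h' <;>
          rcases abs_cases (n + k) with h'' | h'' <;> omega

theorem norm_of_zpow_le (s : Gen) (k : ℤ) : ((FreeGroup.of s ^ k).norm : ℤ) ≤ |k| := by
  rw [Int.abs_eq_natAbs, Int.ofNat_le]
  rcases Int.natAbs_eq k with h | h
  · rw [h, zpow_natCast, FreeGroup.norm_of_pow, Int.natAbs_natCast]
  · rw [h, zpow_neg, FreeGroup.norm_inv_eq, zpow_natCast, FreeGroup.norm_of_pow, Int.natAbs_neg,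
      Int.natAbs_natCast]

/-- A single climb from height `m` to `m + k`, writing `f i` on passing height `i`. -/
theorem exists_path (m : ℤ) (k : ℕ) :
    ∀ f : Fam, (∀ i, f i ≠ 0 → m ≤ i ∧ i ≤ m + k) →
      ∃ w : F, Represents (cPow m * w) f (m + k) ∧ (w.norm : ℤ) ≤ size f + k := by
  have step : ∀ (w : F) (f : Fam) (n : ℤ) (y : Lattice), Represents (cPow m * w) f n →
      ∃ w' : F, Represents (cPow m * w') (f + Finsupp.single n y) n ∧
        (w'.norm : ℤ) ≤ w.norm + nrm y := by
    intro w f n y h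
    have hy : y = Pi.single 0 (y 0) + Pi.single 1 (y 1) := by
      funext i; fin_cases i <;> simp
    refine ⟨w * FreeGroup.of Gen.a ^ y 0 * FreeGroup.of Gen.b ^ y 1, ?_, ?_⟩
    · have := (h.mul_a (y 0)).mul_b (y 1)
      rw [add_assoc, ← Finsupp.single_add, ← hy] at this
      simpa only [mul_assoc] using this
    · have h1 := FreeGroup.norm_mul_le (w * FreeGroup.of Gen.a ^ y 0) (FreeGroup.of Gen.b ^ y 1)
      have h2 := FreeGroup.norm_mul_le w (FreeGroup.of Gen.a ^ y 0)
      have h3 := norm_of_zpow_le Gen.a (y 0)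
      have h4 := norm_of_zpow_le Gen.b (y 1)
      unfold nrm
      omega
  induction k with
  | zero =>
    intro f hf
    obtain ⟨w, hw, hn⟩ := step 1 0 m (f m) (by simpa using Represents.of_cPow m)
    have : f = Finsupp.single m (f m) := by
      ext1 i
      rw [Finsupp.single_apply]
      split_ifs with h
      · rw [h]
      · by_contra hi
        have := hf i hi
        omega
    rw [zero_add, ← this] at hw
    refine ⟨w, by simpa using hw, ?_⟩
    rw [this, size_single]
    simpa using hn
  | succ k ih =>
    intro f hf
    set j : ℤ := m + (k + 1 : ℕ) with hj
    obtain ⟨w, hw, hn⟩ := ih (f.erase j) (fun i hi => by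
      rw [Finsupp.erase_apply] at hi
      split_ifs at hi with h
      · exact absurd rfl hi
      · have := hf i hi
        omega)
    have hw' := hw.mul_cPow 1
    rw [mul_assoc, show m + (k : ℤ) + 1 = j by omega] at hw'
    obtain ⟨w', hw', hn'⟩ := step _ _ j (f j) hw'
    rw [Finsupp.erase_add_single] at hw'
    refine ⟨w', hw', ?_⟩
    have h1 := nrm_add_size_erase f j
    have h2 := FreeGroup.norm_mul_le w (cPow 1)
    have h3 := norm_of_zpow_le Gen.c 1
    rw [abs_one] at h3
    change ((cPow 1).norm : ℤ) ≤ 1 at h3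
    push_cast
    omega

/-- The shortest path through `[m, M]` from `0` to `n` gives a word for a family supported
in `[m, M]`. -/
theorem exists_word (f : Fam) (n m M : ℤ) (h1 : m ≤ 0) (h2 : m ≤ n) (h3 : 0 ≤ M) (h4 : n ≤ M)
    (hf : ∀ i, f i ≠ 0 → m ≤ i ∧ i ≤ M) :
    ∃ w : F, Represents w f n ∧ (w.norm : ℤ) ≤ size f + 2 * (M - m) - |n| := by
  obtain ⟨k, hk⟩ := Int.eq_ofNat_of_zero_le (show 0 ≤ M - m by omega)
  have hM : m + k = M := by omega
  have hc : ∀ i : ℤ, ((cPow i).norm : ℤ) ≤ |i| := norm_of_zpow_le Gen.c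
  rcases le_total 0 n with hn | hn
  · obtain ⟨w, hw, hl⟩ := exists_path m k f (fun i hi => by have := hf i hi; omega)
    rw [hM] at hw
    -- For `n ≥ 0` the route is `0 → m → M → n`.
    refine ⟨cPow m * w * cPow (n - M), by simpa using hw.mul_cPow (n - M), ?_⟩
    have g1 := FreeGroup.norm_mul_le (cPow m * w) (cPow (n - M))
    have g2 := FreeGroup.norm_mul_le (cPow m) w
    have g3 := hc m
    have g4 := hc (n - M)
    rw [abs_of_nonpos (by omega)] at g3 g4
    rw [abs_of_nonneg hn]
    omega
  -- For `n ≤ 0` the route is `0 → M → m → n`. Its descent is a climb read backwards, which negates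
  -- the family; hence the climb is built for `-f`.
  · obtain ⟨w, hw, hl⟩ := exists_path m k (-f) (fun i hi => by
      have := hf i (by simpa using hi)
      omega)
    rw [hM] at hw
    rw [size_neg] at hl
    refine ⟨cPow M * w⁻¹ * cPow (n - m), by simpa using hw.reverse.mul_cPow (n - m), ?_⟩
    have g1 := FreeGroup.norm_mul_le (cPow M * w⁻¹) (cPow (n - m))
    have g2 := FreeGroup.norm_mul_le (cPow M) w⁻¹
    have g3 := hc M
    have g4 := hc (n - m)
    rw [FreeGroup.norm_inv_eq] at g2
    rw [abs_of_nonneg (by omega)] at g3 g4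
    rw [abs_of_nonpos hn]
    omega

/-! ### Comparing minimal lifts with geodesic words -/

theorem exists_isMinFam (R : Lattice ≃+ Lattice) {u : Multiplicative Lattice} {v : Nab}
    (hv : IsMinimalLift R u v) : ∃ f : Fam, toNab f = v ∧ IsMinFam R.toIntLinearEquiv f := by
  obtain ⟨f, hf, hs⟩ := exists_fam v
  refine ⟨f, hf, fun g hg => ?_⟩
  have h1 := hv.2 (toNab g) (by rw [proj_toNab, hg, ← proj_toNab, hf, hv.1])
  have h2 := len_toNab_le g
  omega

theorem exists_word_of_isMinimalLift (R : Lattice ≃+ Lattice) (hR : IsHyperbolic R) :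
    ∃ D : ℕ, ∀ (u : Multiplicative Lattice) (n : ℤ) (v : Nab), IsMinimalLift R u v →
      ∃ w : F, phi w = v ∧
        sigma R w = SemidirectProduct.inl u * SemidirectProduct.inr (Multiplicative.ofAdd n) ∧
        (w.norm : ℤ) - D ≤ wordNorm R
          (SemidirectProduct.inl u * SemidirectProduct.inr (Multiplicative.ofAdd n)) := by
  obtain ⟨τ, hτ, hT⟩ := exists_hasTrace R hR
  obtain ⟨C, hC⟩ := exists_support_near R.toIntLinearEquiv (by linarith) hT (2 * τ)
  -- Widening the interval by `C` at both ends lengthens the word by `2 * (2 * C)`.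
  refine ⟨4 * C, fun u n v hv => ?_⟩
  set g : G R := SemidirectProduct.inl u * SemidirectProduct.inr (Multiplicative.ofAdd n) with hg
  obtain ⟨f, hfv, hf⟩ := exists_isMinFam R hv
  have hfu : Multiplicative.ofAdd (ev R.toIntLinearEquiv f) = u := by
    rw [← proj_toNab, hfv, hv.1]
  obtain ⟨w₀, hw₀, hnorm⟩ := wordNorm_spec R g
  obtain ⟨f₀, n₀, m₀, M₀, hr, h1, h2, h3, h4, h5, h6⟩ := exists_represents_mk w₀.toWord
  rw [FreeGroup.mk_toWord] at hr
  have hσ := (hr.sigma_eq R).symm.trans (hw₀.trans hg)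
  have hn : n₀ = n := by
    have := congrArg SemidirectProduct.right hσ
    simpa using this
  subst hn
  have hu₀ : Multiplicative.ofAdd (ev R.toIntLinearEquiv f₀) = u :=
    SemidirectProduct.inl_injective (mul_right_cancel hσ)
  -- The family of the geodesic may have large entries; it is first replaced by a bounded one of no
  -- greater cost, whose interval still contains `0` and `n`.
  obtain ⟨f₁, m₁, M₁, k1, k2, k3, k4, k5, k6⟩ := exists_bounded_fam R.toIntLinearEquiv hτ hT
    (size f₀).toNat f₀ m₀ M₀ (Int.self_le_toNat _) h5
  have hev : ev R.toIntLinearEquiv f₁ = ev R.toIntLinearEquiv f := by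
    rw [k1]
    exact Multiplicative.ofAdd.injective (hu₀.trans hfu.symm)
  have hsupp := hC f f₁ m₁ M₁ hf hev (fun i => (hf.nrm_lt (by linarith) hT i).le) k2 k5
  obtain ⟨w, hw, hwn⟩ := exists_word f n₀ (m₁ - C) (M₁ + C) (by omega) (by omega) (by omega)
    (by omega) hsupp
  refine ⟨w, hw.phi_eq.trans hfv, ?_, ?_⟩
  · rw [hw.sigma_eq R, hfu]
  -- Minimality gives `size f ≤ size f₁`, so only the widening costs anything.
  · have := hf f₁ hev
    rw [← hnorm]
    unfold FreeGroup.norm at hwn ⊢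
    push_cast
    omega

end SolGroup

theorem mainTheorem6 (R : SolGroup.Lattice ≃+ SolGroup.Lattice) (hR : SolGroup.IsHyperbolic R) :
    ∃ D : ℕ, ∀ (u : Multiplicative SolGroup.Lattice) (n : ℤ) (g : SolGroup.G R),
      g = SemidirectProduct.inl u * SolGroup.gen R SolGroup.Gen.c ^ n →
      (∀ v : SolGroup.Nab, SolGroup.IsMinimalLift R u v →
        ∃ w : SolGroup.F, SolGroup.phi w = v ∧ SolGroup.sigma R w = g ∧
          (w.norm : ℤ) - D ≤ SolGroup.wordNorm R g ∧ SolGroup.wordNorm R g ≤ w.norm) ∧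
      (SolGroup.restrictedNorm R g : ℤ) - D ≤ SolGroup.wordNorm R g ∧
      SolGroup.wordNorm R g ≤ SolGroup.restrictedNorm R g := by
  obtain ⟨D, hD⟩ := SolGroup.exists_word_of_isMinimalLift R hR
  refine ⟨D, fun u n g hg => ?_⟩
  have hc : SolGroup.gen R SolGroup.Gen.c ^ n =
      SemidirectProduct.inr (Multiplicative.ofAdd n) := by
    rw [← SolGroup.sigma_cPow, SolGroup.cPow, map_zpow, SolGroup.sigma, FreeGroup.lift_apply_of]
  rw [hc] at hg
  subst hg
  have hle : ∀ (g : SolGroup.G R) (w : SolGroup.F), SolGroup.sigma R w = g →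
      SolGroup.wordNorm R g ≤ w.norm := fun g w hw => Nat.sInf_le ⟨w, hw, rfl⟩
  refine ⟨fun v hv => ?_, ?_, ?_⟩
  · obtain ⟨w, h1, h2, h3⟩ := hD u n v hv
    exact ⟨w, h1, h2, h3, hle _ w h2⟩
  -- The word found for any one minimal lift competes in the definition of `‖g‖`.
  · obtain ⟨v, hv⟩ := SolGroup.exists_minimalLift R u
    obtain ⟨w, h1, h2, h3⟩ := hD u n v hv
    refine le_trans (sub_le_sub_right ?_ _) h3
    rw [Int.ofNat_le]
    refine Nat.sInf_le ⟨w, h2, ?_, rfl⟩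
    rw [h1]
    simpa using hv
  · obtain ⟨w, h1, -, h3⟩ := SolGroup.restrictedNorm_spec R
      (SemidirectProduct.inl u * SemidirectProduct.inr (Multiplicative.ofAdd n))
    exact h3 ▸ hle _ w h1
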